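/- Let $K\in\mathbb N$, let $\mathcal X_1,\dots,\mathcal X_K$ and $\mathcal Z_1,\dots,\mathcal Z_K$ be Polish spaces, $\mathcal X=\mathcal X_1\times\dots\times\mathcal X_K$, $\mathcal Z=\mathcal Z_1\times\dots\times\mathcal Z_K$. Let $\mu^i\in\mathcal P(\mathcal X_i)$ and $\pi^0\in\mathcal P(\mathcal Z)$ be Borel probability measures and let $\nu^i$ be the $i$-th marginal of $\pi^0$. Let $c_i:\mathcal X_i\times\mathcal Z_i\to\mathbb R$ be continuous with $c_i(x_i,z_i)\ge a_i(x_i)+b_i(z_i)$ for all $(x_i,z_i)$, for some $a_i\in L^1(\mu^i)$, $b_i\in L^1(\nu^i)$, and let $c(\boldsymbol x,\boldsymbol z)=\sum_{i=1}^K c_i(x_i,z_i)$ be the separable cost. Let $\Pi(\mu^i,\nu^i)$ be the set of couplings of $\mu^i$ and $\nu^i$, let $\Pi(\boldsymbol\mu)$ be the set of probability measures on $\mathcal X$ with marginals $\mu^1,\dots,\mu^K$, and let $\Pi(\boldsymbol\mu,\pi^0)$ be the set of probability measures on $\mathcal X\times\mathcal Z$ whose marginal on $\mathcal X_i$ is $\mu^i$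 for each $i$ and whose marginal on $\mathcal Z$ is $\pi^0$. Integrals of costs take values in $(-\infty,+\infty]$. Then all of the following minima are attained, and $$\min_{\gamma\in\Pi(\boldsymbol\mu,\pi^0)}\int c\,d\gamma=\sum_{i=1}^K\ \min_{\gamma^i\in\Pi(\mu^i,\nu^i)}\int c_i\,d\gamma^i .$$ Moreover, let $\gamma^{i,*}$ be any minimizer of $\int c_i\,d\gamma^i$ over $\Pi(\mu^i,\nu^i)$, $i=1,\dots,K$. Each $\gamma^{i,*}$ can be disintegrated as $\gamma^{i,*}(dx_i,dz_i)=\nu^i(dz_i)\,\kappa_i(dx_i|z_i)$ with a Markov kernel $\kappa_i$, and for any such kernels, with $\kappa(d\boldsymbol x|\boldsymbol z):=\kappa_1(dx_1|z_1)\otimes\dots\otimes\kappa_K(dx_K|z_K)$, the plan $$\gamma^*(d\boldsymbol x,d\boldsymbol z)=\pi^0(d\boldsymbol z)\,\kappa(d\boldsymbol x|\boldsymbol z)$$ minimizes $\int c\,d\gamma$ over $\Pi(\boldsymbol\mu,\pi^0)$. Its $\boldsymbol x$-marginal is $\pi^*(d\boldsymbol x)=\int_{\mathcal Z}\pi^0(d\boldsymbol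 z)\,\kappa(d\boldsymbol x|\boldsymbol z)$, and $\pi^*$ is an optimal projection: it minimizes $\pi\mapsto\inf_{\gamma\in\Pi(\pi,\pi^0)}\int c\,d\gamma$ over $\pi\in\Pi(\boldsymbol\mu)$, where $\Pi(\pi,\pi^0)$ is the set of couplings of $\pi$ and $\pi^0$; for $\pi=\pi^*$ this infimum is attained by $\gamma^*$. -/

import Mathlib

open MeasureTheory ProbabilityTheory

noncomputable section

namespace OTProjection

/-- The extended integral `∫ f⁺ dμ - ∫ f⁻ dμ` of a real function. It is the usual integral, with
values in `(-∞, +∞]`, as soon as the negative part of `f` has a finite integral. -/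
def extIntegral {Ω : Type*} [MeasurableSpace Ω] (μ : Measure Ω) (f : Ω → ℝ) : EReal :=
  ((∫⁻ ω, ENNReal.ofReal (f ω) ∂μ : ENNReal) : EReal) -
    ((∫⁻ ω, ENNReal.ofReal (-f ω) ∂μ : ENNReal) : EReal)

/-- `Π(μ, ν)`: the probability measures on `A × B` with marginals `μ` and `ν`. -/
def couplings {A B : Type*} [MeasurableSpace A] [MeasurableSpace B]
    (μ : Measure A) (ν : Measure B) : Set (Measure (A × B)) :=
  {γ | IsProbabilityMeasure γ ∧ γ.map Prod.fst = μ ∧ γ.map Prod.snd = ν}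

/-- `Π(μ¹, …, μᴷ)`: the probability measures on `X₁ × ⋯ × X_K` with marginals `μ¹, …, μᴷ`. -/
def jointLaws {K : ℕ} {X : Fin K → Type*} [∀ i, MeasurableSpace (X i)]
    (μ : ∀ i, Measure (X i)) : Set (Measure (∀ i, X i)) :=
  {π | IsProbabilityMeasure π ∧ ∀ i, π.map (fun x => x i) = μ i}

/-- `Π(μ¹, …, μᴷ, π⁰)`: the probability measures on `(X₁ × ⋯ × X_K) × W` with marginals
`μ¹, …, μᴷ` on the `X i` and `π⁰` on `W`. -/
def multiCouplings {K : ℕ} {X : Fin K → Type*} {W : Type*} [∀ i, MeasurableSpace (X i)]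
    [MeasurableSpace W] (μ : ∀ i, Measure (X i)) (π₀ : Measure W) :
    Set (Measure ((∀ i, X i) × W)) :=
  {γ | IsProbabilityMeasure γ ∧ (∀ i, γ.map (fun p => p.1 i) = μ i) ∧ γ.map Prod.snd = π₀}

/-- `γ` minimizes `∫ c dγ` over the set `S` of plans. -/
def IsOptimal {Ω : Type*} [MeasurableSpace Ω] (S : Set (Measure Ω)) (c : Ω → ℝ)
    (γ : Measure Ω) : Prop :=
  γ ∈ S ∧ ∀ γ' ∈ S, extIntegral γ c ≤ extIntegral γ' c

/-- The optimal value of `∫ c dγ` over the set `S` of plans. -/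
def optValue {Ω : Type*} [MeasurableSpace Ω] (S : Set (Measure Ω)) (c : Ω → ℝ) : EReal :=
  ⨅ γ ∈ S, extIntegral γ c

/-- `π` is an optimal transport projection of `π₀` onto `Π(μ¹, …, μᴷ)`: it minimizes the optimal
transport cost to `π₀` among all joint laws with marginals `μ¹, …, μᴷ`. -/
def IsOptimalProjection {K : ℕ} {X : Fin K → Type*} {W : Type*} [∀ i, MeasurableSpace (X i)]
    [MeasurableSpace W] (μ : ∀ i, Measure (X i)) (π₀ : Measure W)
    (c : (∀ i, X i) × W → ℝ) (π : Measure (∀ i, X i)) : Prop :=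
  π ∈ jointLaws μ ∧
    ∀ π' ∈ jointLaws μ, optValue (couplings π π₀) c ≤ optValue (couplings π' π₀) c

/-- The separable cost `c(x, z) = ∑ i, c_i(x_i, z_i)`. -/
def separableCost {K : ℕ} {X Z : Fin K → Type*} (c : ∀ i, X i × Z i → ℝ) :
    (∀ i, X i) × (∀ i, Z i) → ℝ :=
  fun p => ∑ i, c i (p.1 i, p.2 i)

/-- The product kernel `κ(dx | z) = κ₁(dx₁ | z₁) ⊗ ⋯ ⊗ κ_K(dx_K | z_K)`. -/
def productKernel {K : ℕ} {X Z : Fin K → Type*} [∀ i, MeasurableSpace (X i)]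
    [∀ i, MeasurableSpace (Z i)] (κ : ∀ i, Kernel (Z i) (X i)) [∀ i, IsMarkovKernel (κ i)] :
    Kernel (∀ i, Z i) (∀ i, X i) where
  toFun z := Measure.pi fun i => κ i (z i)
  measurable' := by
    refine Measurable.measure_of_isPiSystem_of_isProbabilityMeasure generateFrom_pi.symm
      isPiSystem_pi ?_
    rintro _ ⟨s, hs, rfl⟩
    have hs' : ∀ i, MeasurableSet (s i) := fun i => hs i (Set.mem_univ i)
    simp only [Measure.pi_pi]
    exact Finset.measurable_prod _ fun i _ =>
      ((κ i).measurable_coe (hs' i)).comp (measurable_pi_apply i)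

/-- The measure `ν(db) κ(da | b)` on `A × B`. -/
def glue {A B : Type*} [MeasurableSpace A] [MeasurableSpace B] (ν : Measure B)
    (κ : Kernel B A) : Measure (A × B) :=
  (ν ⊗ₘ κ).map Prod.swap

end OTProjection

end

open MeasureTheory ProbabilityTheory Topology

/-! A plan in `multiCouplings` projects under each `coordPair i` to a coupling of `μ i` and the
`i`-th marginal of `π₀`, and a separable cost sees only these projections
(`extIntegral_separableCost`). So the sum of the marginal optima is a lower bound. It is reached
because kernels disintegrating the marginal optimizers can be run independently given `z`: the
resulting plan projects exactly onto those optimizers (`map_coordPair_glue`), whatever the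
dependence inside `π₀`. The projection statement follows since every coupling of `π₀` with a joint
law lies in `multiCouplings`.

Marginal optimizers exist by Prokhorov and lower semicontinuity. The lower bound `a + b` is only
integrable, so the topologies are first refined to make representatives of `a` and `b` continuous.
-/

namespace OTProjection

/-! ### Additivity of the extended integral -/

section ExtIntegral

variable {Ω Ω' : Type*} [MeasurableSpace Ω] [MeasurableSpace Ω']

theorem measurable_ofReal_neg {f : Ω → ℝ} (hf : Measurable f) :
    Measurable fun ω => ENNReal.ofReal (-f ω) := by
  fun_prop

theorem extIntegral_map {μ : Measure Ω} {g : Ω → Ω'} (hg : Measurable g) {f : Ω' → ℝ}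
    (hf : Measurable f) : extIntegral (μ.map g) f = extIntegral μ (fun ω => f (g ω)) := by
  unfold extIntegral
  rw [lintegral_map hf.ennreal_ofReal hg, lintegral_map (measurable_ofReal_neg hf) hg]

theorem extIntegral_congr_ae {μ : Measure Ω} {f g : Ω → ℝ} (h : f =ᵐ[μ] g) :
    extIntegral μ f = extIntegral μ g := by
  unfold extIntegral
  congr 2
  · exact lintegral_congr_ae (h.mono fun ω hω => by simp only [hω])
  · exact lintegral_congr_ae (h.mono fun ω hω => by simp only [hω])

theorem extIntegral_of_nonneg {μ : Measure Ω} {f : Ω → ℝ} (h : ∀ ω, 0 ≤ f ω) :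
    extIntegral μ f = ((∫⁻ ω, ENNReal.ofReal (f ω) ∂μ : ENNReal) : EReal) := by
  have h0 : ∀ ω, ENNReal.ofReal (-f ω) = 0 := fun ω =>
    ENNReal.ofReal_of_nonpos (neg_nonpos.2 (h ω))
  simp [extIntegral, h0]

theorem extIntegral_of_integrable {μ : Measure Ω} {f : Ω → ℝ} (h : Integrable f μ) :
    extIntegral μ f = ((∫ ω, f ω ∂μ : ℝ) : EReal) := by
  have hn : ∫⁻ ω, ENNReal.ofReal (-f ω) ∂μ ≠ ⊤ := h.neg.lintegral_lt_top.ne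
  rw [integral_eq_lintegral_pos_part_sub_lintegral_neg_part h, extIntegral, EReal.coe_sub,
    EReal.coe_ennreal_toReal h.lintegral_lt_top.ne, EReal.coe_ennreal_toReal hn]

theorem lintegral_ofReal_neg_add_lt_top {μ : Measure Ω} {f g : Ω → ℝ} (hf : Measurable f)
    (hf' : ∫⁻ ω, ENNReal.ofReal (-f ω) ∂μ < ⊤) (hg' : ∫⁻ ω, ENNReal.ofReal (-g ω) ∂μ < ⊤) :
    ∫⁻ ω, ENNReal.ofReal (-(f ω + g ω)) ∂μ < ⊤ := by
  refine lt_of_le_of_lt (lintegral_mono fun ω => ?_)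
    ((lintegral_add_left (measurable_ofReal_neg hf) _).trans_lt (ENNReal.add_lt_top.2 ⟨hf', hg'⟩))
  rw [neg_add]
  exact ENNReal.ofReal_add_le

/-- Finiteness of the subtracted terms rules out `⊤ - ⊤`: if `p` or `q` is `⊤`, so is `P` and both
sides are `⊤`; otherwise all terms are real. -/
theorem ennreal_sub_add_sub {P N p q m n : ENNReal} (hN : N < ⊤) (hm : m < ⊤) (hn : n < ⊤)
    (h : P + (m + n) = N + (p + q)) :
    (P : EReal) - N = ((p : EReal) - m) + ((q : EReal) - n) := by
  lift N to NNReal using hN.ne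
  lift m to NNReal using hm.ne
  lift n to NNReal using hn.ne
  have key : ∀ x : NNReal, (⊤ : EReal) - ((x : ENNReal) : EReal) = ⊤ := fun x =>
    EReal.top_sub_coe (x : ℝ)
  have nb : ∀ (y : ENNReal) (x : NNReal), (y : EReal) - ((x : ENNReal) : EReal) ≠ ⊥ := by
    intro y x
    induction y using ENNReal.recTopCoe with
    | top => simp [key]
    | coe y => exact EReal.coe_ne_bot ((y : ℝ) - (x : ℝ))
  induction p using ENNReal.recTopCoe with
  | top =>
    have hP : P = ⊤ := by simpa using h
    subst hP
    rw [EReal.coe_ennreal_top, key, key, EReal.top_add_of_ne_bot (nb _ _)]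
  | coe p =>
    induction q using ENNReal.recTopCoe with
    | top =>
      have hP : P = ⊤ := by simpa using h
      subst hP
      rw [EReal.coe_ennreal_top, key, key, EReal.add_top_of_ne_bot (nb _ _)]
    | coe q =>
      have hP : P ≠ ⊤ := by
        rintro rfl
        rw [top_add] at h
        exact (ENNReal.add_lt_top.2 ⟨ENNReal.coe_lt_top, ENNReal.add_lt_top.2
          ⟨ENNReal.coe_lt_top, ENNReal.coe_lt_top⟩⟩).ne h.symm
      lift P to NNReal using hP
      have h' : (P : ℝ) + (m + n) = N + (p + q) := by exact_mod_cast h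
      change (P : ℝ).toEReal - (N : ℝ).toEReal =
        ((p : ℝ).toEReal - (m : ℝ).toEReal) + ((q : ℝ).toEReal - (n : ℝ).toEReal)
      norm_cast
      linarith

theorem extIntegral_add {μ : Measure Ω} {f g : Ω → ℝ} (hf : Measurable f) (hg : Measurable g)
    (hf' : ∫⁻ ω, ENNReal.ofReal (-f ω) ∂μ < ⊤) (hg' : ∫⁻ ω, ENNReal.ofReal (-g ω) ∂μ < ⊤) :
    extIntegral μ (fun ω => f ω + g ω) = extIntegral μ f + extIntegral μ g := by
  refine ennreal_sub_add_sub (lintegral_ofReal_neg_add_lt_top hf hf' hg') hf' hg' ?_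
  have hfg : Measurable fun ω => f ω + g ω := hf.add hg
  -- The identity `(f + g)⁺ + (f⁻ + g⁻) = (f + g)⁻ + (f⁺ + g⁺)` holds pointwise and involves no
  -- subtraction, so it integrates in `ENNReal`.
  rw [← lintegral_add_left (measurable_ofReal_neg hf), ← lintegral_add_left hf.ennreal_ofReal,
    ← lintegral_add_left hfg.ennreal_ofReal,
    ← lintegral_add_left (measurable_ofReal_neg hfg)]
  refine lintegral_congr fun ω => ?_
  have hE : ∀ x : ℝ, ENNReal.ofReal x = ((x.toNNReal : NNReal) : ENNReal) := fun _ => rfl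
  simp only [hE]
  norm_cast
  rw [← NNReal.coe_inj]
  push_cast [Real.coe_toNNReal']
  rcases le_total 0 (f ω) with h1 | h1 <;> rcases le_total 0 (g ω) with h2 | h2 <;>
    rcases le_total 0 (f ω + g ω) with h3 | h3 <;>
    simp [h1, h2, h3, ← neg_add_rev] <;> linarith

theorem extIntegral_sum {ι : Type*} (s : Finset ι) {μ : Measure Ω} {f : ι → Ω → ℝ}
    (hf : ∀ i, Measurable (f i)) (hf' : ∀ i, ∫⁻ ω, ENNReal.ofReal (-f i ω) ∂μ < ⊤) :
    ∫⁻ ω, ENNReal.ofReal (-∑ i ∈ s, f i ω) ∂μ < ⊤ ∧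
      extIntegral μ (fun ω => ∑ i ∈ s, f i ω) = ∑ i ∈ s, extIntegral μ (f i) := by
  classical
  induction s using Finset.induction_on with
  | empty => simp [extIntegral]
  | insert i s hi ih =>
    simp only [Finset.sum_insert hi]
    refine ⟨lintegral_ofReal_neg_add_lt_top (hf i) (hf' i) ih.1, ?_⟩
    rw [extIntegral_add (hf i) (Finset.measurable_sum _ fun j _ => hf j) (hf' i) ih.1, ih.2]

end ExtIntegral

/-! ### Existence of optimal couplings -/

section Existence

/-- By monotone convergence the integral is the supremum of those of the truncations `min f⁺ n`,
which are bounded and continuous, hence have weakly continuous integrals. -/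
theorem lowerSemicontinuous_lintegral {Ω : Type*} [TopologicalSpace Ω] [MeasurableSpace Ω]
    [OpensMeasurableSpace Ω] {f : Ω → ℝ} (hf : Continuous f) :
    LowerSemicontinuous
      (fun γ : ProbabilityMeasure Ω => ∫⁻ ω, ENNReal.ofReal (f ω) ∂(γ : Measure Ω)) := by
  let F : ℕ → BoundedContinuousFunction Ω NNReal := fun n =>
    BoundedContinuousFunction.mkOfBound
      ⟨fun ω => min (f ω).toNNReal n, (continuous_real_toNNReal.comp hf).min continuous_const⟩ n (by
        intro x y
        rw [NNReal.dist_eq, abs_sub_le_iff]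
        constructor
        · have : ((min (f x).toNNReal n : NNReal) : ℝ) ≤ n := by
            exact_mod_cast min_le_right _ _
          have := (min (f y).toNNReal (n : NNReal)).coe_nonneg
          simp only [ContinuousMap.coe_mk]
          linarith
        · have : ((min (f y).toNNReal n : NNReal) : ℝ) ≤ n := by
            exact_mod_cast min_le_right _ _
          have := (min (f x).toNNReal (n : NNReal)).coe_nonneg
          simp only [ContinuousMap.coe_mk]
          linarith)
  have hF : ∀ n ω, F n ω = min (f ω).toNNReal n := fun _ _ => rfl
  have hsup : (fun γ : ProbabilityMeasure Ω => ∫⁻ ω, ENNReal.ofReal (f ω) ∂(γ : Measure Ω)) =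
      fun γ : ProbabilityMeasure Ω => ⨆ n, ∫⁻ ω, (F n ω : ENNReal) ∂(γ : Measure Ω) := by
    funext γ
    rw [← lintegral_iSup]
    · refine lintegral_congr fun ω => le_antisymm ?_ (iSup_le fun n => ?_)
      · obtain ⟨n, hn⟩ := exists_nat_ge (f ω).toNNReal
        refine le_iSup_of_le n ?_
        rw [hF, min_eq_left hn]
        exact le_rfl
      · rw [hF]
        exact ENNReal.coe_le_coe.2 (min_le_left _ _)
    · exact fun n => (F n).continuous.measurable.coe_nnreal_ennreal
    · intro m n hmn ω
      simp only [hF]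
      exact ENNReal.coe_le_coe.2 (min_le_min_left _ (by exact_mod_cast hmn))
  rw [hsup]
  refine lowerSemicontinuous_iSup fun n => Continuous.lowerSemicontinuous ?_
  rw [continuous_iff_continuousAt]
  intro γ
  exact (ProbabilityMeasure.tendsto_iff_forall_lintegral_tendsto.1
    (continuous_id.continuousAt (x := γ))) (F n)

theorem prod_mem_couplings {A B : Type*} [MeasurableSpace A] [MeasurableSpace B]
    (μ : Measure A) [IsProbabilityMeasure μ] (ν : Measure B) [IsProbabilityMeasure ν] :
    μ.prod ν ∈ couplings μ ν :=
  ⟨inferInstance, Measure.fst_prod, Measure.snd_prod⟩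

/-- Comparable Polish topologies have the same Borel sets, so the refinement leaves the measurable
structure alone. -/
theorem exists_finer_polish {A : Type*} [tA : TopologicalSpace A] [hA : PolishSpace A]
    [MeasurableSpace A] [hB : BorelSpace A] {f : A → ℝ} (hf : Measurable f) :
    ∃ t : TopologicalSpace A, t ≤ tA ∧ Continuous[t, _] f ∧
      @PolishSpace A t ∧ @BorelSpace A t _ := by
  obtain ⟨t, ht, hft, hp⟩ := hf.exists_continuous
  refine ⟨t, ht, hft, hp, @BorelSpace.mk A t _ ?_⟩
  exact hB.measurable_eq.trans (@borel_eq_borel_of_le A t tA hp hA ht).symm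

variable {A B : Type*} [TopologicalSpace A] [PolishSpace A] [MeasurableSpace A] [BorelSpace A]
  [TopologicalSpace B] [PolishSpace B] [MeasurableSpace B] [BorelSpace B]
  (μ : Measure A) [IsProbabilityMeasure μ] (ν : Measure B) [IsProbabilityMeasure ν]

/-- Prokhorov: the marginal maps are weakly continuous, which gives closedness, and tightness of the
two fixed marginals gives tightness of the couplings. -/
theorem isCompact_couplings :
    IsCompact {γ : ProbabilityMeasure (A × B) | (γ : Measure (A × B)) ∈ couplings μ ν} := by
  have hclosed :
      IsClosed {γ : ProbabilityMeasure (A × B) | (γ : Measure (A × B)) ∈ couplings μ ν} := by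
    let μ' : ProbabilityMeasure A := ⟨μ, inferInstance⟩
    let ν' : ProbabilityMeasure B := ⟨ν, inferInstance⟩
    have : {γ : ProbabilityMeasure (A × B) | (γ : Measure (A × B)) ∈ couplings μ ν} =
        {γ | γ.map continuous_fst.measurable.aemeasurable = μ'} ∩
        {γ | γ.map continuous_snd.measurable.aemeasurable = ν'} := by
      ext γ
      refine ⟨fun h => ⟨Subtype.ext h.2.1, Subtype.ext h.2.2⟩, fun h => ⟨γ.2, ?_, ?_⟩⟩
      · exact congrArg Subtype.val h.1
      · exact congrArg Subtype.val h.2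
    rw [this]
    exact (isClosed_eq (ProbabilityMeasure.continuous_map continuous_fst) continuous_const).inter
      (isClosed_eq (ProbabilityMeasure.continuous_map continuous_snd) continuous_const)
  rw [← hclosed.closure_eq]
  refine isCompact_closure_of_isTightMeasureSet (IsTightMeasureSet.prodMk ?_ ?_)
  · refine (isTightMeasureSet_singleton (μ := μ)).subset ?_
    rintro _ ⟨_, ⟨γ, hγ, rfl⟩, rfl⟩
    exact hγ.2.1
  · refine (isTightMeasureSet_singleton (μ := ν)).subset ?_
    rintro _ ⟨_, ⟨γ, hγ, rfl⟩, rfl⟩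
    exact hγ.2.2

theorem exists_isMinOn_lintegral_couplings {f : A × B → ℝ} (hf : Continuous f) :
    ∃ γ ∈ couplings μ ν, ∀ γ' ∈ couplings μ ν,
      ∫⁻ p, ENNReal.ofReal (f p) ∂γ ≤ ∫⁻ p, ENNReal.ofReal (f p) ∂γ' := by
  obtain ⟨γ, hγ, hmin⟩ := LowerSemicontinuousOn.exists_isMinOn
    (s := {γ : ProbabilityMeasure (A × B) | (γ : Measure (A × B)) ∈ couplings μ ν})
    ⟨⟨μ.prod ν, inferInstance⟩, prod_mem_couplings μ ν⟩ (isCompact_couplings μ ν)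
    ((lowerSemicontinuous_lintegral hf).lowerSemicontinuousOn _)
  exact ⟨γ, hγ, fun γ' hγ' => hmin (a := ⟨γ', hγ'.1⟩) hγ'⟩

/-- The integral of `a' + b'` is the same finite constant for every coupling, so only the
nonnegative remainder has to be minimized. -/
theorem exists_isOptimal_couplings_of_continuous {c : A × B → ℝ} (hc : Continuous c)
    {a a' : A → ℝ} {b b' : B → ℝ} (ha' : Continuous a') (hb' : Continuous b')
    (haa : a =ᵐ[μ] a') (hbb : b =ᵐ[ν] b') (ha : Integrable a' μ) (hb : Integrable b' ν)
    (h : ∀ x z, a x + b z ≤ c (x, z)) : ∃ γ, IsOptimal (couplings μ ν) c γ := by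
  -- The bound is known for `a`, `b`, not for `a'`, `b'`; the difference may be negative on a set
  -- that is null for every coupling, hence the truncation.
  let f : A × B → ℝ := fun p => max (c p - (a' p.1 + b' p.2)) 0
  have hf : Continuous f := by fun_prop
  have hf0 : ∀ p, 0 ≤ f p := fun p => le_max_right _ _
  have hval : ∀ γ ∈ couplings μ ν, extIntegral γ c =
      ((∫⁻ p, ENNReal.ofReal (f p) ∂γ : ENNReal) : EReal) +
        ((∫ x, a' x ∂μ + ∫ z, b' z ∂ν : ℝ) : EReal) := by
    rintro γ ⟨_, h1, h2⟩
    have m1 : MeasurePreserving Prod.fst γ μ := ⟨measurable_fst, h1⟩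
    have m2 : MeasurePreserving Prod.snd γ ν := ⟨measurable_snd, h2⟩
    have i1 : Integrable (fun p : A × B => a' p.1) γ := m1.integrable_comp_of_integrable ha
    have i2 : Integrable (fun p : A × B => b' p.2) γ := m2.integrable_comp_of_integrable hb
    have hce : c =ᵐ[γ] fun p => f p + (a' p.1 + b' p.2) := by
      filter_upwards [m1.quasiMeasurePreserving.ae_eq_comp haa,
        m2.quasiMeasurePreserving.ae_eq_comp hbb] with p hp1 hp2
      have hp := h p.1 p.2
      simp only [Function.comp_apply] at hp1 hp2
      rw [hp1, hp2] at hp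
      simp only [f]
      rw [max_eq_left (by linarith)]
      ring
    have i12 : Integrable (fun p : A × B => a' p.1 + b' p.2) γ := i1.add i2
    have hfneg : ∫⁻ p, ENNReal.ofReal (-f p) ∂γ < ⊤ := by
      simp only [fun p => ENNReal.ofReal_of_nonpos (neg_nonpos.2 (hf0 p))]
      simp
    rw [extIntegral_congr_ae hce, extIntegral_add hf.measurable (by fun_prop)
      hfneg i12.neg.lintegral_lt_top, extIntegral_of_nonneg hf0,
      extIntegral_of_integrable i12, integral_add i1 i2]
    congr 3
    · rw [← h1, integral_map measurable_fst.aemeasurable ha'.aestronglyMeasurable]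
    · rw [← h2, integral_map measurable_snd.aemeasurable hb'.aestronglyMeasurable]
  obtain ⟨γ, hγ, hmin⟩ := exists_isMinOn_lintegral_couplings μ ν hf
  refine ⟨γ, hγ, fun γ' hγ' => ?_⟩
  rw [hval γ hγ, hval γ' hγ']
  gcongr
  exact EReal.coe_ennreal_le_coe_ennreal_iff.2 (hmin γ' hγ')

/-- Couplings and integrals depend only on the σ-algebras, and `c` stays continuous for finer
topologies, so the topologies can be changed freely. -/
theorem exists_isOptimal_couplings {A B : Type*} [sA : TopologicalSpace A] [PolishSpace A]
    [MeasurableSpace A] [BorelSpace A] [sB : TopologicalSpace B] [PolishSpace B]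
    [MeasurableSpace B] [BorelSpace B] (μ : Measure A) [IsProbabilityMeasure μ] (ν : Measure B)
    [IsProbabilityMeasure ν] {c : A × B → ℝ} (hc : Continuous c)
    {a : A → ℝ} {b : B → ℝ} (ha : Integrable a μ) (hb : Integrable b ν)
    (h : ∀ x z, a x + b z ≤ c (x, z)) : ∃ γ, IsOptimal (couplings μ ν) c γ := by
  obtain ⟨a', ha'm, haa⟩ := ha.aestronglyMeasurable
  obtain ⟨b', hb'm, hbb⟩ := hb.aestronglyMeasurable
  obtain ⟨tA, hA, ha'c, pA, bA⟩ := exists_finer_polish ha'm.measurable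
  obtain ⟨tB, hB, hb'c, pB, bB⟩ := exists_finer_polish hb'm.measurable
  have hc' : @Continuous (A × B) ℝ (@instTopologicalSpaceProd A B tA tB) _ c :=
    continuous_le_dom (inf_le_inf (induced_mono hA) (induced_mono hB) :
      @instTopologicalSpaceProd A B tA tB ≤ @instTopologicalSpaceProd A B sA sB) hc
  exact @exists_isOptimal_couplings_of_continuous A B tA pA _ bA tB pB _ bB μ _ ν _ c hc' a a' b b'
    ha'c hb'c haa hbb (ha.congr haa) (hb.congr hbb) h

end Existence

/-! ### Disintegration, gluing and coordinate projections -/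

section Glue

theorem lintegral_ofReal_neg_lt_top {A B : Type*} [MeasurableSpace A] [MeasurableSpace B]
    {μ : Measure A} {ν : Measure B} {c : A × B → ℝ} {a : A → ℝ} {b : B → ℝ}
    (ha : Integrable a μ) (hb : Integrable b ν) (h : ∀ x z, a x + b z ≤ c (x, z))
    {γ : Measure (A × B)} (hγ : γ ∈ couplings μ ν) :
    ∫⁻ p, ENNReal.ofReal (-c p) ∂γ < ⊤ := by
  have i1 : Integrable (fun p : A × B => a p.1) γ :=
    MeasurePreserving.integrable_comp_of_integrable ⟨measurable_fst, hγ.2.1⟩ ha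
  have i2 : Integrable (fun p : A × B => b p.2) γ :=
    MeasurePreserving.integrable_comp_of_integrable ⟨measurable_snd, hγ.2.2⟩ hb
  refine lt_of_le_of_lt (lintegral_mono fun p => ?_) (i1.add i2).neg.lintegral_lt_top
  exact ENNReal.ofReal_le_ofReal (neg_le_neg (h p.1 p.2))

theorem exists_eq_glue {A B : Type*} [MeasurableSpace A] [StandardBorelSpace A] [Nonempty A]
    [MeasurableSpace B] {μ : Measure A} {ν : Measure B} {γ : Measure (A × B)}
    (hγ : γ ∈ couplings μ ν) : ∃ κ : Kernel B A, IsMarkovKernel κ ∧ γ = glue ν κ := by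
  have := hγ.1
  have : IsProbabilityMeasure (γ.map Prod.swap) :=
    Measure.isProbabilityMeasure_map measurable_swap.aemeasurable
  refine ⟨(γ.map Prod.swap).condKernel, inferInstance, ?_⟩
  have h : (γ.map Prod.swap).fst = ν := by
    rw [Measure.fst, Measure.map_map measurable_fst measurable_swap]
    exact hγ.2.2
  rw [glue, ← h, Measure.disintegrate, Measure.map_map measurable_swap measurable_swap,
    Prod.swap_swap_eq, Measure.map_id]

theorem glue_mem_couplings {A B : Type*} [MeasurableSpace A] [MeasurableSpace B] (ν : Measure B)
    [IsProbabilityMeasure ν] (κ : Kernel B A) [IsMarkovKernel κ] :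
    glue ν κ ∈ couplings (ν.bind κ) ν := by
  refine ⟨Measure.isProbabilityMeasure_map measurable_swap.aemeasurable, ?_, ?_⟩
  · rw [glue, Measure.map_map measurable_fst measurable_swap]
    exact Measure.snd_compProd ν κ
  · rw [glue, Measure.map_map measurable_snd measurable_swap]
    exact Measure.fst_compProd ν κ

variable {K : ℕ} {X Z : Fin K → Type*} [∀ i, MeasurableSpace (X i)] [∀ i, MeasurableSpace (Z i)]

/-- The projection of `(x, z)` to `(x i, z i)`. -/
def coordPair (i : Fin K) (p : (∀ i, X i) × (∀ i, Z i)) : X i × Z i := (p.1 i, p.2 i)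

theorem measurable_coordPair (i : Fin K) : Measurable (coordPair (X := X) (Z := Z) i) := by
  unfold coordPair
  fun_prop

instance isMarkovKernel_productKernel (κ : ∀ i, Kernel (Z i) (X i)) [∀ i, IsMarkovKernel (κ i)] :
    IsMarkovKernel (productKernel κ) :=
  ⟨fun z => inferInstanceAs (IsProbabilityMeasure (Measure.pi fun i => κ i (z i)))⟩

/-- Given `z`, the `i`-th marginal of the product kernel is `κ i (z i)`. It depends on `z` only
through `z i`, so only the `i`-th marginal of `π₀` matters. -/
theorem map_coordPair_glue (π₀ : Measure (∀ i, Z i)) [IsProbabilityMeasure π₀]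
    (κ : ∀ i, Kernel (Z i) (X i)) [∀ i, IsMarkovKernel (κ i)] (i : Fin K) :
    (glue π₀ (productKernel κ)).map (coordPair i) = glue (π₀.map fun z => z i) (κ i) := by
  have hev : Measurable fun z : ∀ i, Z i => z i := measurable_pi_apply i
  have : IsProbabilityMeasure (π₀.map fun z => z i) :=
    Measure.isProbabilityMeasure_map hev.aemeasurable
  refine Measure.ext_of_lintegral _ fun f hf => ?_
  have hfc : Measurable fun p : (∀ i, X i) × (∀ i, Z i) => f (coordPair i p) :=
    hf.comp (measurable_coordPair i)
  have hfs : Measurable fun q : (∀ i, Z i) × (∀ i, X i) => f (coordPair i q.swap) :=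
    hfc.comp measurable_swap
  have hs : Measurable fun q : Z i × X i => f q.swap := hf.comp measurable_swap
  rw [lintegral_map hf (measurable_coordPair i), glue, glue,
    lintegral_map hfc measurable_swap, lintegral_map hf measurable_swap,
    Measure.lintegral_compProd hfs, Measure.lintegral_compProd hs,
    lintegral_map hs.lintegral_kernel_prod_right' hev]
  refine lintegral_congr fun z => ?_
  have hg : Measurable fun x : X i => f (x, z i) := hf.comp measurable_prodMk_right
  exact (measurePreserving_eval (fun i => κ i (z i)) i).lintegral_comp hg

theorem map_coordPair_mem_couplings {μ : ∀ i, Measure (X i)} {π₀ : Measure (∀ i, Z i)}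
    {γ : Measure ((∀ i, X i) × (∀ i, Z i))} (hγ : γ ∈ multiCouplings μ π₀) (i : Fin K) :
    γ.map (coordPair i) ∈ couplings (μ i) (π₀.map fun z => z i) := by
  have := hγ.1
  refine ⟨Measure.isProbabilityMeasure_map (measurable_coordPair i).aemeasurable, ?_, ?_⟩
  · rw [Measure.map_map measurable_fst (measurable_coordPair i)]
    exact hγ.2.1 i
  · rw [Measure.map_map measurable_snd (measurable_coordPair i), ← hγ.2.2,
      Measure.map_map (measurable_pi_apply i) measurable_snd]
    rfl

theorem extIntegral_separableCost {μ : ∀ i, Measure (X i)} {π₀ : Measure (∀ i, Z i)}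
    {c : ∀ i, X i × Z i → ℝ} (hc : ∀ i, Measurable (c i))
    (hneg : ∀ i, ∀ γ ∈ couplings (μ i) (π₀.map fun z => z i),
      ∫⁻ p, ENNReal.ofReal (-c i p) ∂γ < ⊤)
    {γ : Measure ((∀ i, X i) × (∀ i, Z i))} (hγ : γ ∈ multiCouplings μ π₀) :
    extIntegral γ (separableCost c) = ∑ i, extIntegral (γ.map (coordPair i)) (c i) := by
  have hm : ∀ i, Measurable fun p => c i (coordPair i p) := fun i =>
    (hc i).comp (measurable_coordPair i)
  refine (extIntegral_sum Finset.univ hm fun i => ?_).2.trans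
    (Finset.sum_congr rfl fun i _ => (extIntegral_map (measurable_coordPair i) (hc i)).symm)
  have := hneg i _ (map_coordPair_mem_couplings hγ i)
  rwa [lintegral_map (measurable_ofReal_neg (hc i)) (measurable_coordPair i)] at this

theorem couplings_subset_multiCouplings {W : Type*} [MeasurableSpace W] {μ : ∀ i, Measure (X i)}
    {π₀ : Measure W} {π : Measure (∀ i, X i)} (hπ : π ∈ jointLaws μ) :
    couplings π π₀ ⊆ multiCouplings μ π₀ := by
  rintro γ ⟨h, h1, h2⟩
  refine ⟨h, fun i => ?_, h2⟩
  rw [← hπ.2 i, ← h1, Measure.map_map (measurable_pi_apply i) measurable_fst]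
  rfl

theorem glue_productKernel_mem_multiCouplings {μ : ∀ i, Measure (X i)}
    {π₀ : Measure (∀ i, Z i)} [IsProbabilityMeasure π₀]
    (κ : ∀ i, Kernel (Z i) (X i)) [∀ i, IsMarkovKernel (κ i)]
    (h : ∀ i, (glue (π₀.map fun z => z i) (κ i)).map Prod.fst = μ i) :
    glue π₀ (productKernel κ) ∈ multiCouplings μ π₀ := by
  have hg := glue_mem_couplings π₀ (productKernel κ)
  refine ⟨hg.1, fun i => ?_, hg.2.2⟩
  rw [← h i, ← map_coordPair_glue, Measure.map_map measurable_fst (measurable_coordPair i)]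
  rfl

theorem bind_productKernel_mem_jointLaws {μ : ∀ i, Measure (X i)}
    {π₀ : Measure (∀ i, Z i)} [IsProbabilityMeasure π₀]
    (κ : ∀ i, Kernel (Z i) (X i)) [∀ i, IsMarkovKernel (κ i)]
    (h : glue π₀ (productKernel κ) ∈ multiCouplings μ π₀) :
    π₀.bind (productKernel κ) ∈ jointLaws μ := by
  rw [← (glue_mem_couplings π₀ (productKernel κ)).2.1]
  have := h.1
  refine ⟨Measure.isProbabilityMeasure_map measurable_fst.aemeasurable, fun i => ?_⟩
  rw [← h.2.1 i, Measure.map_map (measurable_pi_apply i) measurable_fst]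
  rfl

end Glue

/-! ### Optimality of the glued plan and of its projection -/

theorem IsOptimal.optValue_eq {Ω : Type*} [MeasurableSpace Ω] {S : Set (Measure Ω)} {c : Ω → ℝ}
    {γ : Measure Ω} (h : IsOptimal S c γ) : optValue S c = extIntegral γ c :=
  le_antisymm (iInf₂_le γ h.1) (le_iInf₂ h.2)

/-- Gluing optimal marginal couplings gives an optimal plan. -/
theorem isOptimal_glue_productKernel {K : ℕ} {X Z : Fin K → Type*}
    [∀ i, MeasurableSpace (X i)] [∀ i, MeasurableSpace (Z i)]
    {μ : ∀ i, Measure (X i)} {π₀ : Measure (∀ i, Z i)} [IsProbabilityMeasure π₀]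
    {c : ∀ i, X i × Z i → ℝ} (hc : ∀ i, Measurable (c i))
    (hneg : ∀ i, ∀ γ ∈ couplings (μ i) (π₀.map fun z => z i),
      ∫⁻ p, ENNReal.ofReal (-c i p) ∂γ < ⊤)
    (κ : ∀ i, Kernel (Z i) (X i)) [∀ i, IsMarkovKernel (κ i)]
    (hκ : ∀ i, IsOptimal (couplings (μ i) (π₀.map fun z => z i)) (c i)
      (glue (π₀.map fun z => z i) (κ i))) :
    IsOptimal (multiCouplings μ π₀) (separableCost c) (glue π₀ (productKernel κ)) := by
  have hmem := glue_productKernel_mem_multiCouplings κ fun i => (hκ i).1.2.1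
  refine ⟨hmem, fun γ' hγ' => ?_⟩
  rw [extIntegral_separableCost hc hneg hmem, extIntegral_separableCost hc hneg hγ']
  refine Finset.sum_le_sum fun i _ => ?_
  rw [map_coordPair_glue]
  exact (hκ i).2 _ (map_coordPair_mem_couplings hγ' i)

end OTProjection

open OTProjection in
theorem theoremA2 {K : ℕ} {X Z : Fin K → Type*}
    [∀ i, TopologicalSpace (X i)] [∀ i, PolishSpace (X i)]
    [∀ i, MeasurableSpace (X i)] [∀ i, BorelSpace (X i)]
    [∀ i, TopologicalSpace (Z i)] [∀ i, PolishSpace (Z i)]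
    [∀ i, MeasurableSpace (Z i)] [∀ i, BorelSpace (Z i)]
    (μ : ∀ i, Measure (X i)) [∀ i, IsProbabilityMeasure (μ i)]
    (π₀ : Measure (∀ i, Z i)) [IsProbabilityMeasure π₀]
    (ν : ∀ i, Measure (Z i)) (hν : ∀ i, ν i = π₀.map (fun z => z i))
    (c : ∀ i, X i × Z i → ℝ) (hc : ∀ i, Continuous (c i))
    (hbound : ∀ i, ∃ (a : X i → ℝ) (b : Z i → ℝ), Integrable a (μ i) ∧ Integrable b (ν i) ∧
      ∀ x z, a x + b z ≤ c i (x, z)) :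
    -- all the minima are attained, and the values agree
    (∃ γ, IsOptimal (multiCouplings μ π₀) (separableCost c) γ) ∧
    (∀ i, ∃ γ, IsOptimal (couplings (μ i) (ν i)) (c i) γ) ∧
    optValue (multiCouplings μ π₀) (separableCost c) =
      ∑ i, optValue (couplings (μ i) (ν i)) (c i) ∧
    -- for every choice of optimal marginal couplings
    ∀ γ : ∀ i, Measure (X i × Z i), (∀ i, IsOptimal (couplings (μ i) (ν i)) (c i) (γ i)) →
      -- they can be disintegrated
      (∀ i, ∃ κ : Kernel (Z i) (X i), IsMarkovKernel κ ∧ γ i = glue (ν i) κ) ∧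
      -- and any disintegrations give an optimal plan and an optimal projection
      ∀ (κ : ∀ i, Kernel (Z i) (X i)) [∀ i, IsMarkovKernel (κ i)],
        (∀ i, γ i = glue (ν i) (κ i)) →
        IsOptimal (multiCouplings μ π₀) (separableCost c) (glue π₀ (productKernel κ)) ∧
        (glue π₀ (productKernel κ)).map Prod.fst = π₀.bind (productKernel κ) ∧
        IsOptimalProjection μ π₀ (separableCost c) (π₀.bind (productKernel κ)) ∧
        IsOptimal (couplings (π₀.bind (productKernel κ)) π₀) (separableCost c)
          (glue π₀ (productKernel κ)) := by
  obtain rfl : ν = fun i => π₀.map fun z => z i := funext hν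
  have hev : ∀ i, Measurable fun z : ∀ i, Z i => z i := measurable_pi_apply
  have hprob : ∀ i, IsProbabilityMeasure (π₀.map fun z => z i) := fun i =>
    Measure.isProbabilityMeasure_map (hev i).aemeasurable
  have hcm : ∀ i, Measurable (c i) := fun i => (hc i).measurable
  have hneg : ∀ i, ∀ γ ∈ couplings (μ i) (π₀.map fun z => z i),
      ∫⁻ p, ENNReal.ofReal (-c i p) ∂γ < ⊤ := fun i γ hγ => by
    obtain ⟨a, b, ha, hb, h⟩ := hbound i
    exact lintegral_ofReal_neg_lt_top ha hb h hγ
  have hex : ∀ i, ∃ γ, IsOptimal (couplings (μ i) (π₀.map fun z => z i)) (c i) γ := fun i => by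
    obtain ⟨a, b, ha, hb, h⟩ := hbound i
    exact exists_isOptimal_couplings (μ i) (π₀.map fun z => z i) (hc i) ha hb h
  have hdis : ∀ i, ∀ γ ∈ couplings (μ i) (π₀.map fun z => z i),
      ∃ κ : Kernel (Z i) (X i), IsMarkovKernel κ ∧ γ = glue (π₀.map fun z => z i) κ :=
    fun i γ hγ => by
      -- Conditional kernels take values in a nonempty standard Borel space.
      have : Nonempty (X i) := nonempty_of_isProbabilityMeasure (μ i)
      exact exists_eq_glue hγ
  choose γ₀ hγ₀ using hex
  choose κ₀ hκ₀ hγκ₀ using fun i => hdis i (γ₀ i) (hγ₀ i).1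
  have hopt₀ := isOptimal_glue_productKernel hcm hneg κ₀ fun i => hγκ₀ i ▸ hγ₀ i
  refine ⟨⟨_, hopt₀⟩, fun i => ⟨_, hγ₀ i⟩, ?_, fun γ hγ =>
    ⟨fun i => hdis i (γ i) (hγ i).1, fun κ _ hκ => ?_⟩⟩
  · rw [hopt₀.optValue_eq, extIntegral_separableCost hcm hneg hopt₀.1]
    refine Finset.sum_congr rfl fun i _ => ?_
    rw [(hγ₀ i).optValue_eq, map_coordPair_glue, ← hγκ₀ i]
  · have hopt := isOptimal_glue_productKernel hcm hneg κ fun i => hκ i ▸ hγ i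
    have hg := glue_mem_couplings π₀ (productKernel κ)
    have hπ := bind_productKernel_mem_jointLaws κ hopt.1
    have hopt' : IsOptimal (couplings (π₀.bind (productKernel κ)) π₀) (separableCost c)
        (glue π₀ (productKernel κ)) :=
      ⟨hg, fun γ' hγ' => hopt.2 γ' (couplings_subset_multiCouplings hπ hγ')⟩
    refine ⟨hopt, hg.2.1, ⟨hπ, fun π' hπ' => ?_⟩, hopt'⟩
    -- The glued plan is optimal against all of `multiCouplings`, hence against the couplings of
    -- `π₀` with any competitor `π'`.
    rw [hopt'.optValue_eq]
    exact le_iInf₂ fun γ' hγ' => hopt.2 γ' (couplings_subset_multiCouplings hπ' hγ')
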